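/- Let $M$ be a metric space with distance $d$ and a fixed base point $0\in M$. Let $\mathrm{Lip}_0(M)$ be the Banach space of all Lipschitz functions $f\colon M\to\mathbb R$ with $f(0)=0$, with norm $\|f\|=\sup\{|f(x)-f(y)|/d(x,y)\colon x\neq y\}$, and let $B_{\mathrm{Lip}_0(M)}$ be its closed unit ball. Put $\widetilde M=\{(x,y)\in M\times M\colon x\neq y\}$ and, for $f\in \mathrm{Lip}_0(M)$ and $(x,y)\in\widetilde M$, write $f(m_{x,y})=\frac{f(x)-f(y)}{d(x,y)}$ (the value of $f$ at the molecule $m_{x,y}=\frac{\delta_x-\delta_y}{d(x,y)}$). For $A\subseteq\widetilde M$ let $\pi(A)$ be the set of all $x\in M$ for which there is $y\in M$ with $(x,y)\in A$ or $(y,x)\in A$. Let $ba(\widetilde M)$ be the space of bounded finitely additive signed measures $\mu$ on the power set of $\widetilde M$, with norm the total variation $\|\mu\|=|\mu|(\widetilde M)$. For $\mu\in ba(\widetilde M)$ let $\Phi^*\mu\in \mathrm{Lip}_0(M)^*$ be the functional $(\Phi^*\mu)(f)=\int_{\widetilde M} f(m_{x,y})\,d\mu(x,y)$. The measure $\mu$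 is called optimal if it is positive and $\|\Phi^*\mu\|=\|\mu\|$. A real Banach space $X$ has the local diameter $2$ property (LD$2$P) if every slice $\{x\in B_X\colon x^*(x)>1-\alpha\}$ of its closed unit ball $B_X$, where $x^*\in X^*$, $\|x^*\|=1$ and $\alpha>0$, has diameter $2$. Then $\mathrm{Lip}_0(M)$ has the LD$2$P if and only if for every optimal $\mu\in ba(\widetilde M)$ with $\|\mu\|=1$ and every $\gamma\in(0,1)$ there exist a subset $A$ of $\widetilde M$ with $\mu(A)\geq\gamma$, functions $f,g\in B_{\mathrm{Lip}_0(M)}$, and points $u,v\in M$ with $u\neq v$ such that $f(m_{x,y})\geq\gamma$ and $g(m_{x,y})\geq\gamma$ for all $(x,y)\in A$, and \[ \max\{f(x)-f(y),\,g(y)-g(x)\}+\gamma\, d(u,v)\leq d(x,u)+d(y,v)\qquad\text{for all }x,y\in\pi(A). \] -/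

import Mathlib

open scoped ENNReal

noncomputable section

namespace LipLD

/-! ### The local diameter two property -/

/-- The slice `S(F, α) = {x ∈ B_X : F x > 1 - α}` of the closed unit ball of `X`. -/
def slice {X : Type*} [NormedAddCommGroup X] [NormedSpace ℝ X]
    (F : StrongDual ℝ X) (α : ℝ) : Set X :=
  {x | ‖x‖ ≤ 1 ∧ 1 - α < F x}

/-- `X` has the local diameter two property: every slice of the closed unit ball, given by a
functional of norm one and some `α > 0`, has diameter `2`. -/
def HasLD2P (X : Type*) [NormedAddCommGroup X] [NormedSpace ℝ X] : Prop :=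
  ∀ F : StrongDual ℝ X, ‖F‖ = 1 → ∀ α : ℝ, 0 < α → Metric.diam (slice F α) = 2

/-! ### Bounded finitely additive signed measures on the power set -/

/-- `ba(Ω)`: bounded finitely additive signed measures on the power set of `Ω`. -/
structure BA (Ω : Type*) where
  toFun : Set Ω → ℝ
  additive : ∀ s t : Set Ω, Disjoint s t → toFun (s ∪ t) = toFun s + toFun t
  bounded : ∃ C : ℝ, ∀ s : Set Ω, |toFun s| ≤ C

namespace BA

variable {Ω : Type*}

instance : CoeFun (BA Ω) (fun _ => Set Ω → ℝ) := ⟨BA.toFun⟩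

/-- The norm of `ba(Ω)` is the total variation `|μ|(Ω)`, the supremum of `∑ |μ(E)|` over all
partitions of `Ω` into finitely many sets. -/
instance : Norm (BA Ω) :=
  ⟨fun μ => ⨆ P : Finpartition (Set.univ : Set Ω), ∑ E ∈ P.parts, |μ E|⟩

theorem norm_def (μ : BA Ω) :
    ‖μ‖ = ⨆ P : Finpartition (Set.univ : Set Ω), ∑ E ∈ P.parts, |μ E| := rfl

theorem apply_empty (μ : BA Ω) : μ ∅ = 0 := by
  have h := μ.additive ∅ ∅ (by simp)
  simp only [Set.union_empty] at h
  linarith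

theorem apply_biUnion (μ : BA Ω) {ι : Type*} (S : Finset ι) (E : ι → Set Ω)
    (hS : (S : Set ι).PairwiseDisjoint E) : μ (⋃ i ∈ S, E i) = ∑ i ∈ S, μ (E i) := by
  classical
  induction S using Finset.induction_on with
  | empty => simp [apply_empty]
  | insert a S ha ih =>
    rw [Finset.sum_insert ha, Finset.set_biUnion_insert, μ.additive, ih]
    · exact hS.subset (by simp)
    · rw [Set.disjoint_iUnion₂_right]
      intro i hi
      exact hS (by simp) (by simp [hi]) (fun h => ha (h ▸ hi))

theorem bddAbove_variation (μ : BA Ω) :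
    BddAbove (Set.range fun P : Finpartition (Set.univ : Set Ω) => ∑ E ∈ P.parts, |μ E|) := by
  classical
  obtain ⟨C, hC⟩ := μ.bounded
  refine ⟨C + C, ?_⟩
  rintro _ ⟨P, rfl⟩
  have key : ∀ S ⊆ P.parts, |∑ E ∈ S, μ E| ≤ C := by
    intro S hS
    have h := apply_biUnion μ S id (P.disjoint.subset (by simpa using hS))
    simp only [id] at h
    rw [← h]
    exact hC _
  have h1 := key (P.parts.filter fun E => 0 ≤ μ E) (Finset.filter_subset _ _)
  have h2 := key (P.parts.filter fun E => ¬ 0 ≤ μ E) (Finset.filter_subset _ _)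
  change ∑ E ∈ P.parts, |μ E| ≤ C + C
  rw [← Finset.sum_filter_add_sum_filter_not P.parts (fun E => 0 ≤ μ E)]
  have e1 : ∑ E ∈ P.parts.filter (fun E => 0 ≤ μ E), |μ E|
      = ∑ E ∈ P.parts.filter (fun E => 0 ≤ μ E), μ E :=
    Finset.sum_congr rfl fun E hE => abs_of_nonneg (Finset.mem_filter.1 hE).2
  have e2 : ∑ E ∈ P.parts.filter (fun E => ¬ 0 ≤ μ E), |μ E|
      = -∑ E ∈ P.parts.filter (fun E => ¬ 0 ≤ μ E), μ E := by
    rw [← Finset.sum_neg_distrib]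
    exact Finset.sum_congr rfl fun E hE =>
      abs_of_neg (not_le.1 (Finset.mem_filter.1 hE).2)
  rw [e1, e2]
  have := (abs_le.1 h1).2
  have := (abs_le.1 h2).1
  linarith

theorem sum_abs_le_norm (μ : BA Ω) (P : Finpartition (Set.univ : Set Ω)) :
    ∑ E ∈ P.parts, |μ E| ≤ ‖μ‖ :=
  le_ciSup μ.bddAbove_variation P

theorem norm_nonneg' (μ : BA Ω) : 0 ≤ ‖μ‖ :=
  Real.iSup_nonneg fun _ => Finset.sum_nonneg fun _ _ => abs_nonneg _

/-- `HasIntegral μ f I`: the number `I` is the integral `∫ f dμ`, that is, the limit of the sums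
`∑ f(t_E) μ(E)` with `t_E ∈ E`, over finite partitions directed by refinement. -/
def HasIntegral (μ : BA Ω) (f : Ω → ℝ) (I : ℝ) : Prop :=
  ∀ ε : ℝ, 0 < ε → ∃ P : Finpartition (Set.univ : Set Ω), ∀ Q ≤ P, ∀ c : Set Ω → ℝ,
    (∀ E ∈ Q.parts, c E ∈ f '' E) → |∑ E ∈ Q.parts, c E * μ E - I| ≤ ε

theorem exists_tag (f : Ω → ℝ) (Q : Finpartition (Set.univ : Set Ω)) :
    ∃ c : Set Ω → ℝ, ∀ E ∈ Q.parts, c E ∈ f '' E := by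
  classical
  have h : ∀ E : Set Ω, ∃ r : ℝ, E ∈ Q.parts → r ∈ f '' E := by
    intro E
    by_cases hE : E ∈ Q.parts
    · obtain ⟨x, hx⟩ := Set.nonempty_iff_ne_empty.2 (Q.ne_bot hE)
      exact ⟨f x, fun _ => ⟨x, hx, rfl⟩⟩
    · exact ⟨0, fun h => absurd h hE⟩
  choose c hc using h
  exact ⟨c, fun E hE => hc E hE⟩

theorem exists_common (P Q : Finpartition (Set.univ : Set Ω)) :
    ∃ R : Finpartition (Set.univ : Set Ω), R ≤ P ∧ R ≤ Q := by
  classical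
  exact ⟨P ⊓ Q, inf_le_left, inf_le_right⟩

theorem HasIntegral.unique {μ : BA Ω} {f : Ω → ℝ} {I J : ℝ}
    (hI : HasIntegral μ f I) (hJ : HasIntegral μ f J) : I = J := by
  refine eq_of_forall_dist_le fun ε hε => ?_
  obtain ⟨P, hP⟩ := hI (ε / 2) (by linarith)
  obtain ⟨Q, hQ⟩ := hJ (ε / 2) (by linarith)
  obtain ⟨R, hRP, hRQ⟩ := exists_common P Q
  obtain ⟨c, hc⟩ := exists_tag f R
  have h1 := abs_le.1 (hP R hRP c hc)
  have h2 := abs_le.1 (hQ R hRQ c hc)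
  rw [Real.dist_eq, abs_le]
  constructor <;> linarith [h1.1, h1.2, h2.1, h2.2]

theorem HasIntegral.add {μ : BA Ω} {f g : Ω → ℝ} {I J : ℝ}
    (hI : HasIntegral μ f I) (hJ : HasIntegral μ g J) :
    HasIntegral μ (fun x => f x + g x) (I + J) := by
  intro ε hε
  obtain ⟨P, hP⟩ := hI (ε / 2) (by linarith)
  obtain ⟨Q, hQ⟩ := hJ (ε / 2) (by linarith)
  obtain ⟨R, hRP, hRQ⟩ := exists_common P Q
  refine ⟨R, fun T hT c hc => ?_⟩
  have h : ∀ E : Set Ω, ∃ r : ℝ × ℝ, E ∈ T.parts → r.1 ∈ f '' E ∧ r.2 ∈ g '' E ∧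
      c E = r.1 + r.2 := by
    intro E
    by_cases hE : E ∈ T.parts
    · obtain ⟨x, hx, hxc⟩ := hc E hE
      exact ⟨(f x, g x), fun _ => ⟨⟨x, hx, rfl⟩, ⟨x, hx, rfl⟩, hxc.symm⟩⟩
    · exact ⟨0, fun h => absurd h hE⟩
  choose r hr using h
  have h1 := abs_le.1 (hP T (hT.trans hRP) (fun E => (r E).1) fun E hE => (hr E hE).1)
  have h2 := abs_le.1 (hQ T (hT.trans hRQ) (fun E => (r E).2) fun E hE => (hr E hE).2.1)
  have e : ∑ E ∈ T.parts, c E * μ E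
      = ∑ E ∈ T.parts, (r E).1 * μ E + ∑ E ∈ T.parts, (r E).2 * μ E := by
    rw [← Finset.sum_add_distrib]
    refine Finset.sum_congr rfl fun E hE => ?_
    rw [(hr E hE).2.2]
    ring
  rw [e, abs_le]
  constructor <;> linarith [h1.1, h1.2, h2.1, h2.2]

theorem HasIntegral.const_mul {μ : BA Ω} {f : Ω → ℝ} {I : ℝ} (a : ℝ)
    (hI : HasIntegral μ f I) : HasIntegral μ (fun x => a * f x) (a * I) := by
  intro ε hε
  have ha : 0 < |a| + 1 := by positivity
  obtain ⟨P, hP⟩ := hI (ε / (|a| + 1)) (by positivity)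
  refine ⟨P, fun T hT c hc => ?_⟩
  have h : ∀ E : Set Ω, ∃ r : ℝ, E ∈ T.parts → r ∈ f '' E ∧ c E = a * r := by
    intro E
    by_cases hE : E ∈ T.parts
    · obtain ⟨x, hx, hxc⟩ := hc E hE
      exact ⟨f x, fun _ => ⟨⟨x, hx, rfl⟩, hxc.symm⟩⟩
    · exact ⟨0, fun h => absurd h hE⟩
  choose r hr using h
  have h1 := hP T hT r fun E hE => (hr E hE).1
  have e : ∑ E ∈ T.parts, c E * μ E = a * ∑ E ∈ T.parts, r E * μ E := by
    rw [Finset.mul_sum]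
    refine Finset.sum_congr rfl fun E hE => ?_
    rw [(hr E hE).2]
    ring
  rw [e, ← mul_sub, abs_mul]
  calc |a| * |∑ E ∈ T.parts, r E * μ E - I|
      ≤ (|a| + 1) * (ε / (|a| + 1)) := by gcongr; linarith
    _ = ε := by field_simp

theorem HasIntegral.abs_le {μ : BA Ω} {f : Ω → ℝ} {I C : ℝ}
    (hI : HasIntegral μ f I) (hC : ∀ x, |f x| ≤ C) : |I| ≤ ‖μ‖ * C := by
  refine le_of_forall_pos_le_add fun ε hε => ?_
  obtain ⟨P, hP⟩ := hI ε hε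
  obtain ⟨c, hc⟩ := exists_tag f P
  have h1 := hP P le_rfl c hc
  by_cases hΩ : Nonempty Ω
  · obtain ⟨x₀⟩ := hΩ
    have hC0 : 0 ≤ C := (abs_nonneg _).trans (hC x₀)
    have h2 : |∑ E ∈ P.parts, c E * μ E| ≤ ‖μ‖ * C := by
      calc |∑ E ∈ P.parts, c E * μ E| ≤ ∑ E ∈ P.parts, |c E * μ E| :=
            Finset.abs_sum_le_sum_abs _ _
        _ ≤ ∑ E ∈ P.parts, |μ E| * C := by
            refine Finset.sum_le_sum fun E hE => ?_
            obtain ⟨x, -, hx⟩ := hc E hE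
            rw [abs_mul, mul_comm, ← hx]
            gcongr
            exact hC x
        _ = (∑ E ∈ P.parts, |μ E|) * C := (Finset.sum_mul _ _ _).symm
        _ ≤ ‖μ‖ * C := by
            gcongr
            exact μ.sum_abs_le_norm P
    have h3 := _root_.abs_le.1 h1
    have h4 := _root_.abs_le.1 h2
    rw [_root_.abs_le]
    constructor <;> linarith [h3.1, h3.2, h4.1, h4.2]
  · have hz : ∀ s : Set Ω, μ s = 0 := by
      intro s
      have : s = ∅ := by
        ext x
        exact (hΩ ⟨x⟩).elim
      rw [this, apply_empty]
    have hn : ‖μ‖ = 0 := by simp [norm_def, hz]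
    simp only [hz, mul_zero, Finset.sum_const_zero, zero_sub, abs_neg] at h1
    rw [hn]
    linarith

/-- Partition sums of `f` change by at most `ε ‖μ‖` under refinement of a partition on whose parts
`f` oscillates by at most `ε`. -/
theorem abs_sum_sub_sum_le (μ : BA Ω) (f : Ω → ℝ) {ε : ℝ} (hε : 0 ≤ ε)
    {P Q : Finpartition (Set.univ : Set Ω)} (hQP : Q ≤ P)
    (hP : ∀ F ∈ P.parts, ∀ x ∈ F, ∀ y ∈ F, |f x - f y| ≤ ε) {c c' : Set Ω → ℝ}
    (hc : ∀ E ∈ Q.parts, c E ∈ f '' E) (hc' : ∀ F ∈ P.parts, c' F ∈ f '' F) :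
    |∑ E ∈ Q.parts, c E * μ E - ∑ F ∈ P.parts, c' F * μ F| ≤ ε * ‖μ‖ := by
  classical
  have h : ∀ E : Set Ω, ∃ F : Set Ω, E ∈ Q.parts → F ∈ P.parts ∧ E ⊆ F := by
    intro E
    by_cases hE : E ∈ Q.parts
    · obtain ⟨F, hF, hEF⟩ := hQP hE
      exact ⟨F, fun _ => ⟨hF, hEF⟩⟩
    · exact ⟨∅, fun h => absurd h hE⟩
  choose φ hφ using h
  have hfib : ∀ F ∈ P.parts, μ F = ∑ E ∈ Q.parts.filter (fun E => φ E = F), μ E := by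
    intro F hF
    have h1 := apply_biUnion μ (Q.parts.filter (fun E => φ E = F)) id
      (Q.disjoint.subset (by exact_mod_cast Finset.filter_subset _ _))
    simp only [id] at h1
    rw [← h1]
    congr 1
    ext x
    simp only [Finset.mem_filter, Set.mem_iUnion, exists_prop]
    constructor
    · intro hx
      have hxu : x ∈ Q.parts.sup id := by rw [Q.sup_parts]; trivial
      rw [Finset.sup_id_set_eq_sUnion] at hxu
      obtain ⟨E, hE, hxE⟩ := hxu
      refine ⟨E, ⟨hE, ?_⟩, hxE⟩
      by_contra hne
      have hd := P.disjoint (hφ E hE).1 hF hne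
      exact Set.disjoint_left.1 hd ((hφ E hE).2 hxE) hx
    · rintro ⟨E, ⟨hE, rfl⟩, hxE⟩
      exact (hφ E hE).2 hxE
  have e : ∑ F ∈ P.parts, c' F * μ F = ∑ E ∈ Q.parts, c' (φ E) * μ E := by
    rw [← Finset.sum_fiberwise_of_maps_to (s := Q.parts) (t := P.parts) (g := φ)
      (fun E hE => (hφ E hE).1)]
    refine Finset.sum_congr rfl fun F hF => ?_
    rw [hfib F hF, Finset.mul_sum]
    refine Finset.sum_congr rfl fun E hE => ?_
    rw [(Finset.mem_filter.1 hE).2]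
  rw [e, ← Finset.sum_sub_distrib]
  calc |∑ E ∈ Q.parts, (c E * μ E - c' (φ E) * μ E)|
      ≤ ∑ E ∈ Q.parts, |c E * μ E - c' (φ E) * μ E| := Finset.abs_sum_le_sum_abs _ _
    _ ≤ ∑ E ∈ Q.parts, ε * |μ E| := by
        refine Finset.sum_le_sum fun E hE => ?_
        rw [← sub_mul, abs_mul]
        obtain ⟨x, hx, hxc⟩ := hc E hE
        obtain ⟨y, hy, hyc⟩ := hc' _ (hφ E hE).1
        rw [← hxc, ← hyc]
        gcongr
        exact hP _ (hφ E hE).1 x ((hφ E hE).2 hx) y hy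
    _ = ε * ∑ E ∈ Q.parts, |μ E| := (Finset.mul_sum _ _ _).symm
    _ ≤ ε * ‖μ‖ := by
        gcongr
        exact μ.sum_abs_le_norm Q

theorem exists_partition_osc (f : Ω → ℝ) {C : ℝ} (hC : ∀ x, |f x| ≤ C) {ε : ℝ} (hε : 0 < ε) :
    ∃ P : Finpartition (Set.univ : Set Ω),
      ∀ F ∈ P.parts, ∀ x ∈ F, ∀ y ∈ F, |f x - f y| ≤ ε := by
  classical
  let h : Ω → ℤ := fun x => ⌊f x / ε⌋
  have hfin : (Set.range h).Finite := by
    refine (Set.finite_Icc ⌊-C / ε⌋ ⌊C / ε⌋).subset ?_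
    rintro _ ⟨x, rfl⟩
    have := abs_le.1 (hC x)
    constructor
    · exact Int.floor_mono (by gcongr; exact this.1)
    · exact Int.floor_mono (by gcongr; exact this.2)
  refine ⟨{ parts := hfin.toFinset.image fun k => h ⁻¹' {k}
            supIndep := ?_
            sup_parts := ?_
            bot_notMem := ?_ }, ?_⟩
  · rw [Finset.supIndep_iff_pairwiseDisjoint]
    intro E hE F hF hEF
    simp only [Finset.coe_image, Set.mem_image] at hE hF
    obtain ⟨k, -, rfl⟩ := hE
    obtain ⟨l, -, rfl⟩ := hF
    have hkl : k ≠ l := fun e => hEF (by rw [e])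
    exact Disjoint.preimage h (by simpa using hkl)
  · rw [Finset.sup_id_set_eq_sUnion]
    ext x
    simp only [Set.mem_sUnion, Finset.coe_image, Set.mem_image, Set.mem_univ, iff_true]
    exact ⟨h ⁻¹' {h x}, ⟨h x, by simp, rfl⟩, rfl⟩
  · simp only [Finset.mem_image, not_exists, not_and]
    intro k hk he
    obtain ⟨x, hx⟩ := hfin.mem_toFinset.1 hk
    have : x ∈ h ⁻¹' {k} := hx
    rw [he] at this
    exact this
  · intro F hF x hx y hy
    obtain ⟨k, -, rfl⟩ := Finset.mem_image.1 hF
    have e : ⌊f x / ε⌋ = ⌊f y / ε⌋ := Eq.trans hx (Eq.symm hy)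
    have := Int.abs_sub_lt_one_of_floor_eq_floor e
    rw [← sub_div, abs_div, abs_of_pos hε, div_lt_one hε] at this
    exact this.le

theorem exists_hasIntegral (μ : BA Ω) (f : Ω → ℝ) {C : ℝ} (hC : ∀ x, |f x| ≤ C) :
    ∃ I, HasIntegral μ f I := by
  have hp : ∀ n : ℕ, (0 : ℝ) < 1 / ((n : ℝ) + 1) := fun n => Nat.one_div_pos_of_nat
  choose P hP using fun n => exists_partition_osc f hC (hp n)
  choose c hc using fun n => exists_tag f (P n)
  let a : ℕ → ℝ := fun n => ∑ E ∈ (P n).parts, c n E * μ E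
  have hμ := μ.norm_nonneg'
  have hnm : ∀ n m, |a n - a m| ≤ 1 / ((n : ℝ) + 1) * ‖μ‖ + 1 / ((m : ℝ) + 1) * ‖μ‖ := by
    intro n m
    obtain ⟨R, hRn, hRm⟩ := exists_common (P n) (P m)
    obtain ⟨t, ht⟩ := exists_tag f R
    have h1 := abs_le.1 (abs_sum_sub_sum_le μ f (hp n).le hRn (hP n) ht (hc n))
    have h2 := abs_le.1 (abs_sum_sub_sum_le μ f (hp m).le hRm (hP m) ht (hc m))
    change |∑ E ∈ (P n).parts, c n E * μ E - ∑ E ∈ (P m).parts, c m E * μ E| ≤ _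
    rw [abs_le]
    constructor <;> linarith [h1.1, h1.2, h2.1, h2.2]
  have hlim : Filter.Tendsto (fun n : ℕ => 1 / ((n : ℝ) + 1) * ‖μ‖) Filter.atTop (nhds 0) := by
    simpa using tendsto_one_div_add_atTop_nhds_zero_nat.mul_const ‖μ‖
  have hcau : CauchySeq a := by
    refine cauchySeq_of_le_tendsto_0 (fun n : ℕ => 2 * (1 / ((n : ℝ) + 1) * ‖μ‖)) ?_ ?_
    · intro n m N hn hm
      rw [Real.dist_eq]
      have hn' : 1 / ((n : ℝ) + 1) * ‖μ‖ ≤ 1 / ((N : ℝ) + 1) * ‖μ‖ := by gcongr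
      have hm' : 1 / ((m : ℝ) + 1) * ‖μ‖ ≤ 1 / ((N : ℝ) + 1) * ‖μ‖ := by gcongr
      linarith [hnm n m]
    · simpa using hlim.const_mul 2
  obtain ⟨I, hI⟩ := cauchySeq_tendsto_of_complete hcau
  refine ⟨I, fun ε hε => ?_⟩
  have h1 : ∀ᶠ n in Filter.atTop, |a n - I| < ε / 2 := by
    have := (Metric.tendsto_atTop.1 hI) (ε / 2) (by linarith)
    obtain ⟨N, hN⟩ := this
    exact Filter.eventually_atTop.2 ⟨N, fun n hn => by simpa [Real.dist_eq] using hN n hn⟩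
  have h2 : ∀ᶠ n : ℕ in Filter.atTop, 1 / ((n : ℝ) + 1) * ‖μ‖ < ε / 2 :=
    hlim.eventually (gt_mem_nhds (by linarith))
  obtain ⟨n, hn1, hn2⟩ := (h1.and h2).exists
  refine ⟨P n, fun Q hQ t ht => ?_⟩
  have h3 := abs_le.1 (abs_sum_sub_sum_le μ f (hp n).le hQ (hP n) ht (hc n))
  have h4 := abs_lt.1 hn1
  simp only [a] at h4
  rw [abs_le]
  constructor <;> linarith [h3.1, h3.2, h4.1, h4.2]

/-- The space `ℓ_∞(Ω)` of bounded real functions on `Ω` with the supremum norm. -/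
abbrev LInfty (Ω : Type*) : Type _ := lp (fun _ : Ω => ℝ) ∞

theorem exists_hasIntegral_lp (μ : BA Ω) (f : LInfty Ω) : ∃ I, HasIntegral μ (fun p => f p) I :=
  exists_hasIntegral μ _ fun p => lp.norm_apply_le_norm ENNReal.top_ne_zero f p

/-- The integral `f ↦ ∫ f dμ` as a bounded linear functional on `ℓ_∞(Ω)`. -/
def integral (μ : BA Ω) : StrongDual ℝ (LInfty Ω) :=
  LinearMap.mkContinuous
    { toFun := fun f => (exists_hasIntegral_lp μ f).choose
      map_add' := fun f g => (exists_hasIntegral_lp μ (f + g)).choose_spec.unique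
        ((exists_hasIntegral_lp μ f).choose_spec.add (exists_hasIntegral_lp μ g).choose_spec)
      map_smul' := fun a f => (exists_hasIntegral_lp μ (a • f)).choose_spec.unique
        ((exists_hasIntegral_lp μ f).choose_spec.const_mul a) }
    ‖μ‖
    (fun f => (exists_hasIntegral_lp μ f).choose_spec.abs_le
      fun p => lp.norm_apply_le_norm ENNReal.top_ne_zero f p)

theorem hasIntegral_integral (μ : BA Ω) (f : LInfty Ω) :
    HasIntegral μ (fun p => f p) (μ.integral f) :=
  (exists_hasIntegral_lp μ f).choose_spec

end BA

/-! ### Spaces of Lipschitz functions -/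

/-- Real Lipschitz functions on `M` vanishing at the base point `o`, as a vector space. -/
def lipSubmodule (M : Type*) [MetricSpace M] (o : M) : Submodule ℝ (M → ℝ) where
  carrier := {f | (∃ K, LipschitzWith K f) ∧ f o = 0}
  add_mem' := by
    rintro f g ⟨⟨K, hK⟩, hf⟩ ⟨⟨L, hL⟩, hg⟩
    exact ⟨⟨K + L, hK.add hL⟩, by simp [hf, hg]⟩
  zero_mem' := ⟨⟨0, LipschitzWith.const 0⟩, rfl⟩
  smul_mem' := by
    rintro a f ⟨⟨K, hK⟩, hf⟩
    exact ⟨⟨‖a‖₊ * K, (lipschitzWith_smul a).comp hK⟩, by simp [hf]⟩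

/-- `Lip_0(M)` for the metric space `M` with base point `o`. -/
def Lip0 (M : Type*) [MetricSpace M] (o : M) : Type _ := lipSubmodule M o

/-- `M̃ = {(x, y) : x ≠ y}`. -/
abbrev OffDiag (M : Type*) : Type _ := {p : M × M // p.1 ≠ p.2}

namespace Lip0

variable {M : Type*} [MetricSpace M] {o : M}

instance : AddCommGroup (Lip0 M o) := inferInstanceAs (AddCommGroup (lipSubmodule M o))

instance : Module ℝ (Lip0 M o) := inferInstanceAs (Module ℝ (lipSubmodule M o))

instance : FunLike (Lip0 M o) M ℝ where
  coe f := f.1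
  coe_injective := fun _ _ h => Subtype.ext h

@[simp] theorem add_apply (f g : Lip0 M o) (x : M) : (f + g) x = f x + g x := rfl

@[simp] theorem smul_apply (a : ℝ) (f : Lip0 M o) (x : M) : (a • f) x = a * f x := rfl

@[simp] theorem zero_apply (x : M) : (0 : Lip0 M o) x = 0 := rfl

theorem exists_lipschitzWith (f : Lip0 M o) : ∃ K, LipschitzWith K (f : M → ℝ) := f.2.1

@[simp] theorem map_base (f : Lip0 M o) : f o = 0 := f.2.2

/-- The slope `f̃(x, y) = (f x - f y) / d(x, y)`, i.e. the value `f(m_{x,y})` of `f` at the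
molecule `m_{x,y} = (δ_x - δ_y) / d(x, y)`. -/
def slope (f : Lip0 M o) (p : OffDiag M) : ℝ := (f p.1.1 - f p.1.2) / dist p.1.1 p.1.2

theorem exists_abs_slope_le (f : Lip0 M o) : ∃ C : ℝ, ∀ p, |slope f p| ≤ C := by
  obtain ⟨K, hK⟩ := f.exists_lipschitzWith
  refine ⟨K, fun p => ?_⟩
  rw [slope, abs_div, abs_of_nonneg dist_nonneg]
  refine div_le_of_le_mul₀ dist_nonneg K.2 ?_
  simpa [Real.dist_eq] using hK.dist_le_mul p.1.1 p.1.2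

theorem memℓp_slope (f : Lip0 M o) : Memℓp (slope f) ∞ := by
  obtain ⟨C, hC⟩ := exists_abs_slope_le f
  refine memℓp_infty ⟨C, ?_⟩
  rintro _ ⟨p, rfl⟩
  exact hC p

/-- De Leeuw's map as a linear map. -/
def deLeeuwₗ : Lip0 M o →ₗ[ℝ] BA.LInfty (OffDiag M) where
  toFun f := ⟨slope f, memℓp_slope f⟩
  map_add' f g := by
    ext p
    change slope (f + g) p = slope f p + slope g p
    simp only [slope, add_apply]
    ring
  map_smul' a f := by
    ext p
    change slope (a • f) p = a * slope f p
    simp only [slope, smul_apply]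
    ring

/-- The norm of `Lip_0(M)` is the best Lipschitz constant
`sup {|f x - f y| / d(x, y) : x ≠ y}`. -/
instance : Norm (Lip0 M o) :=
  ⟨fun f => ⨆ p : OffDiag M, |f p.1.1 - f p.1.2| / dist p.1.1 p.1.2⟩

theorem norm_def (f : Lip0 M o) :
    ‖f‖ = ⨆ p : OffDiag M, |f p.1.1 - f p.1.2| / dist p.1.1 p.1.2 := rfl

theorem norm_deLeeuwₗ (f : Lip0 M o) : ‖deLeeuwₗ f‖ = ‖f‖ := by
  rw [lp.norm_eq_ciSup, norm_def]
  congr 1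
  ext p
  change |slope f p| = _
  rw [slope, abs_div, abs_of_nonneg dist_nonneg]

theorem deLeeuwₗ_injective : Function.Injective (deLeeuwₗ (M := M) (o := o)) := by
  rw [injective_iff_map_eq_zero]
  intro f hf
  refine DFunLike.ext _ _ fun x => ?_
  by_cases hx : x = o
  · rw [hx, map_base, map_base]
  · have h : slope f ⟨(x, o), hx⟩ = 0 :=
      congrFun (congrArg (fun g : BA.LInfty (OffDiag M) => (g : OffDiag M → ℝ)) hf) ⟨(x, o), hx⟩
    rw [slope, div_eq_zero_iff] at h
    rcases h with h | h
    · simpa using h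
    · exact absurd (dist_eq_zero.1 h) hx

theorem core : NormedSpace.Core ℝ (Lip0 M o) where
  norm_nonneg f := by
    rw [← norm_deLeeuwₗ]
    exact norm_nonneg _
  norm_smul a f := by
    rw [← norm_deLeeuwₗ, ← norm_deLeeuwₗ, map_smul, norm_smul]
  norm_triangle f g := by
    rw [← norm_deLeeuwₗ, ← norm_deLeeuwₗ, ← norm_deLeeuwₗ, map_add]
    exact norm_add_le _ _
  norm_eq_zero_iff f := by
    rw [← norm_deLeeuwₗ, norm_eq_zero]
    exact map_eq_zero_iff _ deLeeuwₗ_injective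

instance : NormedAddCommGroup (Lip0 M o) := NormedAddCommGroup.ofCore core

instance : NormedSpace ℝ (Lip0 M o) := NormedSpace.ofCore core

/-- De Leeuw's map `Φ : Lip_0(M) → ℓ_∞(M̃)`, `Φ f = f̃`. -/
def deLeeuw : Lip0 M o →L[ℝ] BA.LInfty (OffDiag M) :=
  deLeeuwₗ.mkContinuous 1 fun f => by rw [norm_deLeeuwₗ, one_mul]

@[simp] theorem deLeeuw_apply (f : Lip0 M o) (p : OffDiag M) : deLeeuw f p = slope f p := rfl

end Lip0

/-- `Φ^* μ ∈ Lip_0(M)^*`, i.e. `f ↦ ∫ f̃ dμ`. -/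
def deLeeuwAdjoint {M : Type*} [MetricSpace M] (o : M) (μ : BA (OffDiag M)) :
    StrongDual ℝ (Lip0 M o) :=
  μ.integral.comp Lip0.deLeeuw

/-- `μ` is optimal: it is positive and `‖Φ^* μ‖ = ‖μ‖`. -/
def IsOptimal {M : Type*} [MetricSpace M] (o : M) (μ : BA (OffDiag M)) : Prop :=
  (∀ A : Set (OffDiag M), 0 ≤ μ A) ∧ ‖deLeeuwAdjoint o μ‖ = ‖μ‖

/-- `π(A) ⊆ M`: the points occurring as a coordinate of some pair in `A`. -/
def coords {M : Type*} (A : Set (OffDiag M)) : Set M :=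
  {x | ∃ p ∈ A, p.1.1 = x ∨ p.1.2 = x}

end LipLD

end

/-! Every functional of norm one on `Lip_0(M)` integrates slopes against an optimal measure `μ` of
norm one (`exists_isOptimal`), so slices can be studied through such `μ`. Slopes of functions in the
unit ball lie in `[-1, 1]`, hence `∫ f̃ dμ` is near `1` precisely when `f̃` is near `1` on a set of
`μ`-measure near `1`. The quantitative halves of this are `one_sub_le_apply` and `apply_le_one_sub`.

Two functions of the unit ball are almost at distance `2` when, for some `u ≠ v`, one grows from `u`
to `v` and the other from `v` to `u` at rate almost `1`. If `f`, `g` in a thin slice do so, both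
have large slope on a common large set `A`, and the inequality of the criterion follows from `(f x -
f u) + (f v - f y) ≤ d(x,u) + d(y,v)` and its analogue for `g`.

Conversely, that inequality is the room a McShane-type extension needs to keep the values on `π(A)`
and still grow at rate `γ` between `u` and `v` (`exists_lipschitz_eqOn`). The modified functions
have the same slopes on `A`, so they lie in the slice, and they are at distance at least `2γ`. -/

namespace LipLD

/-! ### Positive finitely additive measures and positive functionals on `ℓ_∞` -/

namespace BA

variable {Ω : Type*}

theorem sum_inter_parts (μ : BA Ω) (Q : Finpartition (Set.univ : Set Ω)) (A : Set Ω) :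
    ∑ E ∈ Q.parts, μ (E ∩ A) = μ A := by
  have hd : (Q.parts : Set (Set Ω)).PairwiseDisjoint fun E => E ∩ A := fun E hE F hF hEF =>
    (Q.disjoint hE hF hEF).mono Set.inter_subset_left Set.inter_subset_left
  rw [← apply_biUnion μ Q.parts (fun E => E ∩ A) hd]
  congr 1
  ext x
  have hx : x ∈ Q.parts.sup id := by rw [Q.sup_parts]; trivial
  rw [Finset.sup_id_set_eq_sUnion] at hx
  obtain ⟨E, hE, hxE⟩ := hx
  simp only [Set.mem_iUnion, Set.mem_inter_iff, exists_prop]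
  exact ⟨fun ⟨_, _, _, h⟩ => h, fun h => ⟨E, hE, hxE, h⟩⟩

theorem sum_parts (μ : BA Ω) (Q : Finpartition (Set.univ : Set Ω)) :
    ∑ E ∈ Q.parts, μ E = μ Set.univ := by
  simpa using sum_inter_parts μ Q Set.univ

theorem norm_eq_apply_univ (μ : BA Ω) (hμ : ∀ A, 0 ≤ μ A) : ‖μ‖ = μ Set.univ := by
  -- Some partition must exist: a real supremum over an empty family would be `0`.
  obtain ⟨P, -⟩ := exists_partition_osc (fun _ : Ω => (0 : ℝ)) (C := 0) (by simp) one_pos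
  have : Nonempty (Finpartition (Set.univ : Set Ω)) := ⟨P⟩
  have h : ∀ Q : Finpartition (Set.univ : Set Ω), ∑ E ∈ Q.parts, |μ E| = μ Set.univ := fun Q => by
    rw [← sum_parts μ Q]
    exact Finset.sum_congr rfl fun E _ => abs_of_nonneg (hμ E)
  simp [norm_def, h]

/-- The indicator function of a set as an element of `ℓ_∞(Ω)`. -/
noncomputable def ind (A : Set Ω) : LInfty Ω :=
  ⟨A.indicator 1, memℓp_infty ⟨1, by
    rintro _ ⟨x, rfl⟩
    by_cases h : x ∈ A <;> simp [h]⟩⟩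

theorem ind_of_mem {A : Set Ω} {x : Ω} (h : x ∈ A) : ind A x = 1 := Set.indicator_of_mem h _

theorem ind_of_notMem {A : Set Ω} {x : Ω} (h : x ∉ A) : ind A x = 0 :=
  Set.indicator_of_notMem h _

theorem HasIntegral.nonneg {μ : BA Ω} (hμ : ∀ A, 0 ≤ μ A) {f : Ω → ℝ} {I : ℝ}
    (hI : HasIntegral μ f I) (hf : ∀ x, 0 ≤ f x) : 0 ≤ I := by
  refine le_of_forall_pos_le_add fun ε hε => ?_
  obtain ⟨P, hP⟩ := hI ε hε
  obtain ⟨c, hc⟩ := exists_tag f P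
  have h := (_root_.abs_le.1 (hP P le_rfl c hc)).2
  have : 0 ≤ ∑ E ∈ P.parts, c E * μ E := Finset.sum_nonneg fun E hE => by
    obtain ⟨x, -, hx⟩ := hc E hE
    exact mul_nonneg (hx ▸ hf x) (hμ E)
  linarith

theorem hasIntegral_ind (μ : BA Ω) (A : Set Ω) : HasIntegral μ (fun x => ind A x) (μ A) := by
  intro ε hε
  -- Oscillation at most `1/2` forces a `0`-`1` valued function to be constant on each part, so the
  -- partition sums equal `μ A` exactly.
  obtain ⟨P, hP⟩ := exists_partition_osc (fun x => ind A x) (C := 1)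
    (fun x => by by_cases h : x ∈ A <;> simp [ind_of_mem, ind_of_notMem, h])
    (show (0 : ℝ) < 1 / 2 by norm_num)
  refine ⟨P, fun Q hQ c hc => ?_⟩
  have key : ∑ E ∈ Q.parts, c E * μ E = μ A := by
    rw [← sum_inter_parts μ Q A]
    refine Finset.sum_congr rfl fun E hE => ?_
    obtain ⟨F, hF, hEF⟩ := hQ hE
    obtain ⟨x, hxE, hx⟩ := hc E hE
    rw [← hx]
    by_cases hxA : x ∈ A
    · have : E ∩ A = E := Set.inter_eq_left.2 fun y hy => by
        by_contra hyA
        have := hP F hF x (hEF hxE) y (hEF hy)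
        rw [ind_of_mem hxA, ind_of_notMem hyA] at this
        norm_num at this
      simp only [ind_of_mem hxA, one_mul, this]
    · have : E ∩ A = ∅ := by
        ext y
        simp only [Set.mem_inter_iff, Set.mem_empty_iff_false, iff_false, not_and]
        intro hy hyA
        have := hP F hF x (hEF hxE) y (hEF hy)
        rw [ind_of_notMem hxA, ind_of_mem hyA] at this
        norm_num at this
      simp only [ind_of_notMem hxA, zero_mul, this, apply_empty]
  rw [key, sub_self, abs_zero]
  exact hε.le

theorem integral_ind (μ : BA Ω) (A : Set Ω) : μ.integral (ind A) = μ A :=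
  (hasIntegral_integral μ _).unique (hasIntegral_ind μ A)

theorem integral_mono {μ : BA Ω} (hμ : ∀ A, 0 ≤ μ A) {f g : LInfty Ω} (h : ∀ x, f x ≤ g x) :
    μ.integral f ≤ μ.integral g := by
  rw [← sub_nonneg, ← map_sub]
  exact (hasIntegral_integral μ (g - f)).nonneg hμ fun x => sub_nonneg.2 (h x)

/-- The additive set function `A ↦ G 1_A` of a monotone linear functional on `ℓ_∞(Ω)`. -/
noncomputable def ofMonotone (G : LInfty Ω →ₗ[ℝ] ℝ) (hG : ∀ f : LInfty Ω, (∀ x, 0 ≤ f x) → 0 ≤ G f) : BA Ω where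
  toFun A := G (ind A)
  additive s t hst := by
    rw [← map_add]
    congr 1
    ext x
    exact congrFun (Set.indicator_union_of_disjoint hst 1) x
  bounded := by
    refine ⟨G (ind Set.univ), fun s => ?_⟩
    have h0 : 0 ≤ G (ind s) := hG _ fun x => Set.indicator_nonneg (fun _ _ => zero_le_one) x
    have h1 : 0 ≤ G (ind Set.univ - ind s) := hG _ fun x => by
      change 0 ≤ ind Set.univ x - ind s x
      rw [ind_of_mem (Set.mem_univ x)]
      by_cases h : x ∈ s <;> simp [ind_of_mem, ind_of_notMem, h]
    rw [abs_of_nonneg h0]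
    rw [map_sub] at h1
    linarith

theorem ofMonotone_apply (G : LInfty Ω →ₗ[ℝ] ℝ) (hG) (A : Set Ω) :
    ofMonotone G hG A = G (ind A) := rfl

/-- A tagged partition sum is `G` of a step function. On a fine partition this step function is
uniformly `δ`-close to `f`, and positivity of `G` turns this into an error of at most `δ * G 1`. -/
theorem integral_ofMonotone (G : LInfty Ω →ₗ[ℝ] ℝ) (hG) (f : LInfty Ω) :
    (ofMonotone G hG).integral f = G f := by
  have mono : ∀ f g : LInfty Ω, (∀ x, f x ≤ g x) → G f ≤ G g := fun f g h => by
    rw [← sub_nonneg, ← map_sub]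
    exact hG _ fun x => sub_nonneg.2 (h x)
  have hu : 0 ≤ G (ind Set.univ) := hG _ fun x => Set.indicator_nonneg (fun _ _ => zero_le_one) x
  refine (hasIntegral_integral _ f).unique fun ε hε => ?_
  -- The `+ 1` covers the case `G 1 = 0`.
  have hδ : 0 < ε / (G (ind Set.univ) + 1) := by positivity
  set δ := ε / (G (ind Set.univ) + 1) with hδ'
  have hδε : δ * G (ind Set.univ) ≤ ε := by
    rw [hδ', div_mul_eq_mul_div, div_le_iff₀ (by positivity)]
    nlinarith
  obtain ⟨P, hP⟩ := exists_partition_osc (fun x => f x) (C := ‖f‖)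
    (fun x => lp.norm_apply_le_norm ENNReal.top_ne_zero f x) hδ
  refine ⟨P, fun Q hQ c hc => ?_⟩
  let s : LInfty Ω := ∑ E ∈ Q.parts, c E • ind E
  have hs : ∑ E ∈ Q.parts, c E * ofMonotone G hG E = G s := by
    simp [s, ofMonotone_apply]
  have hsx : ∀ x, |s x - f x| ≤ δ := by
    intro x
    have hx : x ∈ Q.parts.sup id := by rw [Q.sup_parts]; trivial
    rw [Finset.sup_id_set_eq_sUnion] at hx
    obtain ⟨E, hE, hxE⟩ := hx
    have e : s x = c E := by
      have e1 : s x = ∑ F ∈ Q.parts, c F * ind F x := by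
        simp only [s, lp.coeFn_sum, Finset.sum_apply]
        rfl
      rw [e1, Finset.sum_eq_single_of_mem E hE, ind_of_mem hxE, mul_one]
      intro F hF hFE
      rw [ind_of_notMem, mul_zero]
      exact fun hxF => Set.disjoint_left.1 (Q.disjoint hF hE hFE) hxF hxE
    obtain ⟨F, hF, hEF⟩ := hQ hE
    obtain ⟨y, hy, hyc⟩ := hc E hE
    rw [e, ← hyc]
    exact hP F hF y (hEF hy) x (hEF hxE)
  have hind : ∀ x, (δ • ind Set.univ : LInfty Ω) x = δ := fun x => by
    change δ * ind Set.univ x = δ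
    rw [ind_of_mem (Set.mem_univ x), mul_one]
  have h1 := mono (s - f) (δ • ind Set.univ) fun x => by
    rw [hind]
    exact (abs_le.1 (hsx x)).2
  have h2 := mono (f - s) (δ • ind Set.univ) fun x => by
    rw [hind]
    change f x - s x ≤ δ
    linarith [(abs_le.1 (hsx x)).1]
  rw [map_smul, map_sub, smul_eq_mul] at h1 h2
  rw [hs, abs_le]
  constructor <;> linarith

theorem le_iSup_apply (f : LInfty Ω) (x : Ω) : f x ≤ ⨆ y, f y :=
  le_ciSup (f := fun y => f y) ⟨‖f‖, by
    rintro _ ⟨y, rfl⟩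
    exact (le_abs_self _).trans (lp.norm_apply_le_norm ENNReal.top_ne_zero f y)⟩ x

end BA

/-! ### Representing functionals on `Lip_0(M)` by optimal measures -/

namespace Lip0

variable {M : Type*} [MetricSpace M] {o : M}

theorem abs_slope_le_norm (f : Lip0 M o) (p : OffDiag M) : |slope f p| ≤ ‖f‖ := by
  rw [← norm_deLeeuwₗ]
  exact lp.norm_apply_le_norm ENNReal.top_ne_zero (deLeeuwₗ f) p

theorem slope_swap (f : Lip0 M o) (p : OffDiag M) :
    slope f ⟨(p.1.2, p.1.1), p.2.symm⟩ = -slope f p := by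
  simp only [slope, dist_comm p.1.2 p.1.1]
  ring

theorem slope_sub (f g : Lip0 M o) (p : OffDiag M) : slope (f - g) p = slope f p - slope g p := by
  rw [← deLeeuw_apply, map_sub]
  rfl

theorem sub_le_norm_mul_dist (f : Lip0 M o) (x y : M) : f x - f y ≤ ‖f‖ * dist x y := by
  by_cases h : x = y
  · simp [h]
  · have := (abs_le.1 (abs_slope_le_norm f ⟨(x, y), h⟩)).2
    rwa [slope, div_le_iff₀ (dist_pos.2 h)] at this

/-- Swapping the two points of a pair negates the slope, so no absolute value is needed in the
supremum. -/
theorem norm_le_iSup_slope [Nonempty (OffDiag M)] (f : Lip0 M o) :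
    ‖f‖ ≤ ⨆ p, deLeeuw f p := by
  rw [norm_def]
  refine ciSup_le fun p => ?_
  have e : |f p.1.1 - f p.1.2| / dist p.1.1 p.1.2 = |slope f p| := by
    rw [slope, abs_div, abs_of_nonneg dist_nonneg]
  rw [e, abs_le']
  refine ⟨BA.le_iSup_apply (deLeeuw f) p, ?_⟩
  rw [← slope_swap]
  exact BA.le_iSup_apply (deLeeuw f) _

/-- A `1`-Lipschitz function, translated to vanish at the base point. -/
def ofLipschitz (o : M) (h : M → ℝ) (hh : LipschitzWith 1 h) : Lip0 M o :=
  ⟨fun x => h x - h o, ⟨1, by simpa using hh.sub (LipschitzWith.const (h o))⟩, sub_self _⟩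

theorem ofLipschitz_apply (h : M → ℝ) (hh : LipschitzWith 1 h) (x : M) :
    ofLipschitz o h hh x = h x - h o := rfl

theorem norm_ofLipschitz_le (h : M → ℝ) (hh : LipschitzWith 1 h) : ‖ofLipschitz o h hh‖ ≤ 1 := by
  rw [norm_def]
  refine Real.iSup_le (fun p => ?_) zero_le_one
  refine div_le_one_of_le₀ ?_ dist_nonneg
  simpa [ofLipschitz_apply, Real.dist_eq] using hh.dist_le_mul p.1.1 p.1.2

/-- Hahn–Banach, dominated by the sublinear functional `h ↦ sup h` rather than by the norm: an
extension below `sup` is automatically positive and takes the value `1` at the constant `1`. -/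
theorem exists_isOptimal (F : StrongDual ℝ (Lip0 M o)) (hF : ‖F‖ = 1) :
    ∃ μ : BA (OffDiag M), IsOptimal o μ ∧ ‖μ‖ = 1 ∧ deLeeuwAdjoint o μ = F := by
  -- With no pairs of distinct points the space is zero and carries no functional of norm one.
  have hne : Nonempty (OffDiag M) := by
    by_contra hn
    rw [not_nonempty_iff] at hn
    have : F = 0 := by
      ext f
      have : f = 0 := by
        rw [← norm_eq_zero, norm_def, Real.iSup_of_isEmpty]
      simp [this]
    simp [this] at hF
  let Φ := deLeeuwₗ (M := M) (o := o)
  let e := LinearEquiv.ofInjective Φ deLeeuwₗ_injective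
  let T : BA.LInfty (OffDiag M) →ₗ.[ℝ] ℝ :=
    ⟨LinearMap.range Φ, (F : Lip0 M o →ₗ[ℝ] ℝ) ∘ₗ e.symm.toLinearMap⟩
  have hT : ∀ f, T (e f) = F f := fun f => by
    change F (e.symm (e f)) = F f
    rw [e.symm_apply_apply]
  obtain ⟨G, hGT, hGN⟩ := exists_extension_of_le_sublinear T (fun h => ⨆ p, h p)
    (fun c hc h => by
      change (⨆ p, c * h p) = _
      rw [Real.mul_iSup_of_nonneg hc.le])
    (fun g h => ciSup_le fun p => add_le_add (BA.le_iSup_apply g p) (BA.le_iSup_apply h p))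
    (fun h => by
      obtain ⟨f, rfl⟩ := e.surjective h
      rw [hT]
      calc F f ≤ ‖F‖ * ‖f‖ := (le_abs_self _).trans (F.le_opNorm f)
        _ = ‖f‖ := by rw [hF, one_mul]
        _ ≤ _ := norm_le_iSup_slope f)
  have hG : ∀ h : BA.LInfty (OffDiag M), (∀ p, 0 ≤ h p) → 0 ≤ G h := fun h hh => by
    have h1 := hGN (-h)
    have h2 : (⨆ p, (-h) p) ≤ 0 := ciSup_le fun p => neg_nonpos.2 (hh p)
    rw [map_neg] at h1
    linarith
  let μ := BA.ofMonotone G hG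
  have hpos : ∀ A, 0 ≤ μ A := fun A =>
    hG _ fun x => Set.indicator_nonneg (fun _ _ => zero_le_one) x
  have hadj : deLeeuwAdjoint o μ = F := by
    ext f
    change μ.integral (deLeeuw f) = F f
    rw [BA.integral_ofMonotone, ← hT f, ← hGT]
    rfl
  have hμ : ‖μ‖ = 1 := by
    rw [BA.norm_eq_apply_univ μ hpos]
    refine le_antisymm ((hGN _).trans (ciSup_le fun p => ?_)) ?_
    · rw [BA.ind_of_mem (Set.mem_univ p)]
    · have h1 := hGN (-BA.ind Set.univ)
      have h2 : (⨆ p, (-BA.ind Set.univ : BA.LInfty (OffDiag M)) p) ≤ -1 := ciSup_le fun p => by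
        change -(BA.ind Set.univ p) ≤ -1
        rw [BA.ind_of_mem (Set.mem_univ p)]
      rw [map_neg] at h1
      change 1 ≤ G (BA.ind Set.univ)
      linarith
  exact ⟨μ, ⟨hpos, by rw [hadj, hF, hμ]⟩, hμ, hadj⟩

end Lip0

/-- A `1`-Lipschitz function can be changed off `S` so that it increases from `u` to `v` at rate
at least `γ`, if the values on `S` leave room for this. -/
theorem exists_lipschitz_eqOn {M : Type*} [MetricSpace M] {S : Set M} (hS : S.Nonempty) {f : M → ℝ}
    (hf : ∀ x y, f x - f y ≤ dist x y) {γ : ℝ} (hγ : γ ≤ 1) {u v : M}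
    (h : ∀ x ∈ S, ∀ y ∈ S, f x - f y + γ * dist u v ≤ dist x u + dist y v) :
    ∃ k : M → ℝ, LipschitzWith 1 k ∧ (∀ x ∈ S, k x = f x) ∧ γ * dist u v ≤ k v - k u := by
  have : Nonempty S := hS.to_subtype
  have hbdd : BddBelow (Set.range fun y : S => f y + dist (y : M) v) := by
    refine ⟨f v, ?_⟩
    rintro _ ⟨y, rfl⟩
    have := hf v y
    rw [dist_comm] at this
    simp only
    linarith
  -- The largest value at `v` that a `1`-Lipschitz function agreeing with `f` on `S` can take.
  set c := ⨅ y : S, (f y + dist (y : M) v) with hc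
  have hcle : ∀ y ∈ S, c ≤ f y + dist y v := fun y hy => ciInf_le hbdd ⟨y, hy⟩
  have hvc : f v ≤ c := le_ciInf fun y => by
    have := hf v y
    rw [dist_comm] at this
    linarith
  -- The supremum of these cones is the smallest `1`-Lipschitz function with the values of `f` on
  -- `S` and `c` at `v`; the index `none` stands for `v`. Being smallest keeps its value at `u` low.
  let w : Option S → M → ℝ := fun i z => i.elim (c - dist v z) fun x => f x - dist (x : M) z
  have hwb : ∀ z, BddAbove (Set.range fun i => w i z) := fun z => by
    refine ⟨max (c - dist v z) (f z), ?_⟩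
    rintro _ ⟨_ | x, rfl⟩
    · exact le_max_left _ _
    · have := hf x z
      exact le_max_of_le_right (by simp only [w, Option.elim_some]; linarith)
  refine ⟨fun z => ⨆ i, w i z, ?_, fun x hx => ?_, ?_⟩
  · refine LipschitzWith.of_le_add fun y z => ciSup_le fun i => ?_
    refine le_trans ?_ (add_le_add_left (le_ciSup (hwb z) i) _)
    rcases i with _ | x
    · have := dist_triangle v y z
      simp only [w, Option.elim_none]
      linarith
    · have := dist_triangle (x : M) y z
      simp only [w, Option.elim_some]
      linarith
  · refine le_antisymm (ciSup_le fun i => ?_) ?_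
    · rcases i with _ | y
      · have := hcle x hx
        rw [dist_comm] at this
        simp only [w, Option.elim_none]
        linarith
      · have := hf y x
        simp only [w, Option.elim_some]
        linarith
    · have := le_ciSup (hwb x) (some ⟨x, hx⟩)
      simpa [w] using this
  · have h1 : c ≤ ⨆ i, w i v := by simpa [w] using le_ciSup (hwb v) none
    have h2 : (⨆ i, w i u) ≤ c - γ * dist u v := ciSup_le fun i => by
      rcases i with _ | x
      · simp only [w, Option.elim_none, dist_comm v u]
        nlinarith [dist_nonneg (x := u) (y := v)]
      · have : f x - dist (x : M) u + γ * dist u v ≤ c := le_ciInf fun y => by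
          have := h x x.2 y y.2
          linarith
        simp only [w, Option.elim_some]
        linarith
    simp only
    linarith

/-! ### Slices and large slopes -/

section Slices

variable {M : Type*} [MetricSpace M] {o : M}

/-- Integrate the pointwise bound `(1 + γ) 1_A - 1 ≤ f̃`: the slope is at least `γ` on `A` and at
least `-1` elsewhere. -/
theorem one_sub_le_apply {μ : BA (OffDiag M)} (hμ : IsOptimal o μ) (hμ1 : ‖μ‖ = 1) {γ : ℝ}
    {A : Set (OffDiag M)} {f : Lip0 M o} (hf : ‖f‖ ≤ 1) (hA : ∀ p ∈ A, γ ≤ f.slope p) :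
    (1 + γ) * μ A - 1 ≤ deLeeuwAdjoint o μ f := by
  have h := BA.integral_mono hμ.1 (f := (1 + γ) • BA.ind A - BA.ind Set.univ) (g := Lip0.deLeeuw f)
    fun p => by
      change (1 + γ) * BA.ind A p - BA.ind Set.univ p ≤ f.slope p
      rw [BA.ind_of_mem (Set.mem_univ p)]
      by_cases hp : p ∈ A
      · rw [BA.ind_of_mem hp]
        linarith [hA p hp]
      · rw [BA.ind_of_notMem hp]
        linarith [(abs_le.1 (Lip0.abs_slope_le_norm f p)).1]
  rw [map_sub, map_smul, BA.integral_ind, BA.integral_ind, ← BA.norm_eq_apply_univ μ hμ.1, hμ1,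
    smul_eq_mul] at h
  exact h

/-- A Chebyshev-type bound: `f̃` is at most `1` everywhere and loses at least `1 - γ` where it is
below `γ`. -/
theorem apply_le_one_sub {μ : BA (OffDiag M)} (hμ : IsOptimal o μ) (hμ1 : ‖μ‖ = 1) {γ : ℝ}
    {f : Lip0 M o} (hf : ‖f‖ ≤ 1) :
    deLeeuwAdjoint o μ f ≤ 1 - (1 - γ) * μ {p | γ ≤ f.slope p}ᶜ := by
  have h := BA.integral_mono hμ.1 (f := Lip0.deLeeuw f)
    (g := BA.ind Set.univ - (1 - γ) • BA.ind {p | γ ≤ f.slope p}ᶜ) fun p => by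
      change f.slope p ≤ BA.ind Set.univ p - (1 - γ) * BA.ind {p | γ ≤ f.slope p}ᶜ p
      rw [BA.ind_of_mem (Set.mem_univ p)]
      by_cases hp : γ ≤ f.slope p
      · rw [BA.ind_of_notMem (by simpa using hp)]
        linarith [(abs_le.1 (Lip0.abs_slope_le_norm f p)).2]
      · rw [BA.ind_of_mem (by simpa using hp)]
        linarith
  rw [map_sub, map_smul, BA.integral_ind, BA.integral_ind, ← BA.norm_eq_apply_univ μ hμ.1, hμ1,
    smul_eq_mul] at h
  exact h

/-- Changing `f` off the coordinates of `A` gives a function in the unit ball with large slope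
from `u` to `v`, and the same slopes on `A`. -/
theorem exists_modification {A : Set (OffDiag M)} (hA : A.Nonempty) {f : Lip0 M o} (hf : ‖f‖ ≤ 1)
    {γ : ℝ} (hγ : γ ≤ 1) {u v : M}
    (h : ∀ x ∈ coords A, ∀ y ∈ coords A, f x - f y + γ * dist u v ≤ dist x u + dist y v) :
    ∃ k : Lip0 M o, ‖k‖ ≤ 1 ∧ (∀ p ∈ A, k.slope p = f.slope p) ∧ γ * dist u v ≤ k v - k u := by
  obtain ⟨p, hp⟩ := hA
  obtain ⟨k, hk, hkS, hkuv⟩ := exists_lipschitz_eqOn (S := coords A) ⟨p.1.1, p, hp, Or.inl rfl⟩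
    (f := f) (fun x y => (Lip0.sub_le_norm_mul_dist f x y).trans
      (mul_le_of_le_one_left dist_nonneg hf)) hγ h
  refine ⟨Lip0.ofLipschitz o k hk, Lip0.norm_ofLipschitz_le k hk, fun q hq => ?_, ?_⟩
  · simp only [Lip0.slope, Lip0.ofLipschitz_apply, hkS _ ⟨q, hq, Or.inl rfl⟩,
      hkS _ ⟨q, hq, Or.inr rfl⟩]
    ring
  · simp only [Lip0.ofLipschitz_apply]
    linarith

theorem slice_subset_closedBall {X : Type*} [NormedAddCommGroup X] [NormedSpace ℝ X]
    (F : StrongDual ℝ X) (α : ℝ) : slice F α ⊆ Metric.closedBall 0 1 := fun x hx => by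
  simpa using hx.1

theorem diam_slice_le {X : Type*} [NormedAddCommGroup X] [NormedSpace ℝ X]
    (F : StrongDual ℝ X) (α : ℝ) : Metric.diam (slice F α) ≤ 2 :=
  (Metric.diam_mono (slice_subset_closedBall F α) Metric.isBounded_closedBall).trans
    ((Metric.diam_closedBall zero_le_one).trans (by norm_num))

end Slices

end LipLD

/-! ### The two implications -/

open LipLD in
theorem LipLD.exists_of_hasLD2P {M : Type*} [MetricSpace M] {o : M} (h : HasLD2P (Lip0 M o))
    {μ : BA (OffDiag M)} (hμ : IsOptimal o μ) (hμ1 : ‖μ‖ = 1) {γ : ℝ} (hγ0 : 0 < γ) (hγ1 : γ < 1) :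
    ∃ A : Set (OffDiag M), γ ≤ μ A ∧ ∃ f g : Lip0 M o, ‖f‖ ≤ 1 ∧ ‖g‖ ≤ 1 ∧
      ∃ u v : M, u ≠ v ∧ (∀ p ∈ A, γ ≤ f.slope p ∧ γ ≤ g.slope p) ∧
        ∀ x ∈ coords A, ∀ y ∈ coords A,
          max (f x - f y) (g y - g x) + γ * dist u v ≤ dist x u + dist y v := by
  -- With this width, each member of the slice has slope below `γ` only on a set of measure at most
  -- `(1 - γ) / 2`, so two members share a good set of measure at least `γ`.
  have hα : 0 < (1 - γ) ^ 2 / 2 := by nlinarith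
  have hdiam := h (deLeeuwAdjoint o μ) (hμ.2.trans hμ1) _ hα
  obtain ⟨f, hf, g, hg, hfg⟩ : ∃ f ∈ slice (deLeeuwAdjoint o μ) ((1 - γ) ^ 2 / 2),
      ∃ g ∈ slice (deLeeuwAdjoint o μ) ((1 - γ) ^ 2 / 2), 1 + γ < dist f g := by
    by_contra! hcon
    have := Metric.diam_le_of_forall_dist_le (by linarith) hcon
    linarith
  have hne : Nonempty (OffDiag M) := by
    by_contra hn
    rw [not_nonempty_iff] at hn
    have : ‖f - g‖ = 0 := by rw [Lip0.norm_def, Real.iSup_of_isEmpty]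
    rw [dist_eq_norm, this] at hfg
    linarith
  -- As both slopes lie in `[-1, 1]`, a difference above `1 + γ` forces that of `f` to be at least
  -- `γ` and that of `g` at most `-γ`.
  obtain ⟨p, hp⟩ : ∃ p, 1 + γ < (f - g).slope p := by
    by_contra! hcon
    have := (Lip0.norm_le_iSup_slope (f - g)).trans (ciSup_le hcon)
    rw [dist_eq_norm] at hfg
    linarith
  rw [Lip0.slope_sub] at hp
  have hd : 0 < dist p.1.1 p.1.2 := dist_pos.2 p.2
  have hfp : γ * dist p.1.1 p.1.2 ≤ f p.1.1 - f p.1.2 := by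
    rw [← le_div_iff₀ hd]
    have := (abs_le.1 (Lip0.abs_slope_le_norm g p)).1
    change γ ≤ f.slope p
    linarith [hg.1]
  have hgp : γ * dist p.1.1 p.1.2 ≤ g p.1.2 - g p.1.1 := by
    have := (abs_le.1 (Lip0.abs_slope_le_norm f p)).2
    have h1 : g.slope p ≤ -γ := by linarith [hf.1]
    rw [Lip0.slope, div_le_iff₀ hd] at h1
    linarith
  have hmeas : ∀ k ∈ slice (deLeeuwAdjoint o μ) ((1 - γ) ^ 2 / 2),
      μ {p | γ ≤ k.slope p}ᶜ ≤ (1 - γ) / 2 := fun k hk => by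
    have h1 := hk.2.trans_le (apply_le_one_sub (γ := γ) hμ hμ1 hk.1)
    have h2 : 0 < 1 - γ := by linarith
    refine le_of_mul_le_mul_left ?_ h2
    nlinarith
  set B := {p : OffDiag M | γ ≤ f.slope p} with hB
  set C := {p : OffDiag M | γ ≤ g.slope p} with hC
  have hAB : γ ≤ μ (B ∩ C) := by
    have e1 : μ Set.univ = μ B + μ Bᶜ := by
      rw [← μ.additive _ _ disjoint_compl_right, Set.union_compl_self]
    have e2 : μ B = μ (B ∩ C) + μ (B \ C) := by
      rw [← μ.additive _ _ Set.disjoint_sdiff_inter.symm, Set.inter_union_sdiff]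
    have e3 : μ Cᶜ = μ (B \ C) + μ (Cᶜ \ B) := by
      rw [← μ.additive]
      · congr 1
        ext q
        simp only [Set.mem_compl_iff, Set.mem_union, Set.mem_sdiff]
        tauto
      · exact Set.disjoint_left.2 fun q hq hq' => hq'.2 hq.1
    rw [← BA.norm_eq_apply_univ μ hμ.1, hμ1] at e1
    linarith [hmeas f hf, hmeas g hg, hμ.1 (Cᶜ \ B)]
  have lip : ∀ k : Lip0 M o, ‖k‖ ≤ 1 → ∀ x y, k x - k y ≤ dist x y := fun k hk x y =>
    (Lip0.sub_le_norm_mul_dist k x y).trans (mul_le_of_le_one_left dist_nonneg hk)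
  refine ⟨B ∩ C, hAB, f, g, hf.1, hg.1, p.1.2, p.1.1, p.2.symm, fun q hq => hq, fun x _ y _ => ?_⟩
  rw [← le_sub_iff_add_le, dist_comm p.1.2]
  refine max_le ?_ ?_
  · have := lip f hf.1 x p.1.2
    have := lip f hf.1 p.1.1 y
    rw [dist_comm p.1.1 y] at this
    linarith
  · have := lip g hg.1 y p.1.1
    have := lip g hg.1 p.1.2 x
    rw [dist_comm p.1.2 x] at this
    linarith

theorem proposition3p4 {M : Type*} [MetricSpace M] (o : M) :
    LipLD.HasLD2P (LipLD.Lip0 M o) ↔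
      ∀ μ : LipLD.BA (LipLD.OffDiag M), LipLD.IsOptimal o μ → ‖μ‖ = 1 →
        ∀ γ : ℝ, 0 < γ → γ < 1 →
          ∃ A : Set (LipLD.OffDiag M), γ ≤ μ A ∧
            ∃ f g : LipLD.Lip0 M o, ‖f‖ ≤ 1 ∧ ‖g‖ ≤ 1 ∧
              ∃ u v : M, u ≠ v ∧
                (∀ p ∈ A, γ ≤ f.slope p ∧ γ ≤ g.slope p) ∧
                ∀ x ∈ LipLD.coords A, ∀ y ∈ LipLD.coords A,
                  max (f x - f y) (g y - g x) + γ * dist u v ≤ dist x u + dist y v := by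
  refine ⟨fun h μ hμ hμ1 γ hγ0 hγ1 => LipLD.exists_of_hasLD2P h hμ hμ1 hγ0 hγ1,
    fun h F hF α hα => le_antisymm (LipLD.diam_slice_le F α) ?_⟩
  obtain ⟨μ, hμ, hμ1, rfl⟩ := LipLD.Lip0.exists_isOptimal F hF
  refine le_of_forall_pos_sub_le fun ε hε => ?_
  -- With `γ = 1 - δ`, `(1 + γ) * γ - 1 = 1 - 3δ + δ²`, which exceeds `1 - α` because `δ ≤ α / 4`.
  obtain ⟨γ, hγ0, hγ1, hγε, hγα⟩ : ∃ γ : ℝ, 0 < γ ∧ γ < 1 ∧ 2 - ε ≤ 2 * γ ∧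
      1 - α < (1 + γ) * γ - 1 := by
    have hδ : 0 < min (1 / 2) (min (ε / 2) (α / 4)) := by positivity
    have h1 := min_le_left (1 / 2) (min (ε / 2) (α / 4))
    have h2 := (min_le_right (1 / 2) (min (ε / 2) (α / 4))).trans (min_le_left _ _)
    have h3 := (min_le_right (1 / 2) (min (ε / 2) (α / 4))).trans (min_le_right _ _)
    set δ := min (1 / 2) (min (ε / 2) (α / 4))
    exact ⟨1 - δ, by linarith, by linarith, by linarith, by nlinarith⟩
  obtain ⟨A, hA, f, g, hf, hg, u, v, huv, hslope, hroom⟩ := h μ hμ hμ1 γ hγ0 hγ1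
  have hAne : A.Nonempty := by
    rw [Set.nonempty_iff_ne_empty]
    rintro rfl
    rw [μ.apply_empty] at hA
    linarith
  obtain ⟨k, hk, hkA, hkuv⟩ := LipLD.exists_modification hAne hf hγ1.le (u := u) (v := v)
    fun x hx y hy => (add_le_add_left (le_max_left _ _) _).trans (hroom x hx y hy)
  -- For `g` the roles of `u` and `v` are exchanged, so that `l` grows in the opposite direction to
  -- `k`.
  obtain ⟨l, hl, hlA, hluv⟩ := LipLD.exists_modification hAne hg hγ1.le (u := v) (v := u)
    fun y hy x hx => by
      rw [dist_comm v u, add_comm (dist y v)]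
      exact (add_le_add_left (le_max_right _ _) _).trans (hroom x hx y hy)
  have hmem : ∀ m : LipLD.Lip0 M o, ‖m‖ ≤ 1 → (∀ p ∈ A, γ ≤ m.slope p) →
      m ∈ LipLD.slice (LipLD.deLeeuwAdjoint o μ) α := fun m hm hmA => by
    refine ⟨hm, hγα.trans_le (le_trans ?_ (LipLD.one_sub_le_apply hμ hμ1 hm hmA))⟩
    gcongr
  have hdist : 2 * γ ≤ dist k l := by
    rw [dist_eq_norm]
    refine le_trans ?_ ((le_abs_self _).trans
      (LipLD.Lip0.abs_slope_le_norm (k - l) ⟨(v, u), huv.symm⟩))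
    rw [LipLD.Lip0.slope_sub, LipLD.Lip0.slope, LipLD.Lip0.slope, ← sub_div,
      le_div_iff₀ (dist_pos.2 huv.symm), dist_comm v u]
    rw [dist_comm v u] at hluv
    linarith
  exact (hγε.trans hdist).trans (Metric.dist_le_diam_of_mem
    (Metric.isBounded_closedBall.subset (LipLD.slice_subset_closedBall _ α))
    (hmem k hk fun p hp => (hkA p hp).symm ▸ (hslope p hp).1)
    (hmem l hl fun p hp => (hlA p hp).symm ▸ (hslope p hp).2))
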